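/- Let $K$ be an algebraically closed field of characteristic different from $2$, and let $\Gamma\subset\mathbb P^3_K$ be the twisted cubic, the image of $\mathbb P^1$ under $(t_0:t_1)\mapsto(t_0^3:t_0^2t_1:t_0t_1^2:t_1^3)$. An irreducible surface of degree $4$ is the zero locus of an irreducible homogeneous polynomial of degree $4$. A plane curve has a cusp at a point if the point is a double point of the curve whose tangent cone is a double line $\ell^2=0$; the cusp is ordinary if in addition the cubic term of the local equation is not divisible by $\ell$. A surface has $\Gamma$ as a cuspidal curve if, for all but finitely many $p\in\Gamma$, the section of the surface by every plane through $p$ that does not contain the tangent line to $\Gamma$ at $p$ has a cusp at $p$. Then the tangential developable of $\Gamma$, i.e. the union of the tangent lines to $\Gamma$, is the unique irreducible surface of degree $4$ in $\mathbb P^3$ which has $\Gamma$ as a cuspidal curve. More precisely: 1. The tangential developable is the zero locus of an irreducible homogeneous polynomial $F$ of degree $4$, and it has $\Gamma$ as a cuspidal curve; moreover, at every point $p\in\Gamma$, its section by every plane through $p$ not containing the tangent line to $\Gamma$ at $p$ has an ordinary cusp at $p$. 2. If $G$ is an irreducible homogeneous polynomial of degree $4$ whose zero locus has $\Gamma$ as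 a cuspidal curve, then that zero locus is the tangential developable of $\Gamma$, and $G=cF$ for some $c\in K\setminus\{0\}$. -/

import Mathlib

open scoped LinearAlgebra.Projectivization

noncomputable section

namespace CuspidalQuartic

variable (K : Type*) [Field K]

/-- The surface of `ℙ³` cut out by a form `F` in four variables: the set of points all of whose
homogeneous coordinate vectors are zeros of `F`. -/
def zeroLocus {K : Type*} [Field K] (F : MvPolynomial (Fin 4) K) : Set (ℙ K (Fin 4 → K)) :=
  {P | ∀ x ∈ P.submodule, MvPolynomial.eval x F = 0}

/-- The four binary cubic monomials `(t₀³, t₀²t₁, t₀t₁², t₁³)` of the third Veronese map. -/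
def veroneseForm : Fin 4 → MvPolynomial (Fin 2) K :=
  ![MvPolynomial.X 0 ^ 3, MvPolynomial.X 0 ^ 2 * MvPolynomial.X 1,
    MvPolynomial.X 0 * MvPolynomial.X 1 ^ 2, MvPolynomial.X 1 ^ 3]

variable {K}

/-- The third Veronese map on homogeneous coordinates. The twisted cubic `Γ` is the set of points
`[veronese a]`, `a ≠ 0`; the point depends only on `[a] ∈ ℙ¹`, and `ℙ¹ → Γ` is bijective. -/
def veronese (a : Fin 2 → K) : Fin 4 → K :=
  fun i => MvPolynomial.eval a (veroneseForm K i)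

/-- The partial derivative of the third Veronese map with respect to `t_j`. -/
def veroneseDeriv (j : Fin 2) (a : Fin 2 → K) : Fin 4 → K :=
  fun i => MvPolynomial.eval a (MvPolynomial.pderiv j (veroneseForm K i))

/-- The projective tangent line to `Γ` at `[veronese a]`, as a two-dimensional linear subspace of
`K⁴`: it is spanned by the point and by the image of the differential of the parametrization.
(By Euler's relation the point itself is only needed in characteristic three.) -/
def tangentLine (a : Fin 2 → K) : Submodule K (Fin 4 → K) :=
  Submodule.span K (insert (veronese a) (Set.range fun j => veroneseDeriv j a))

variable (K) in
/-- The tangential developable of `Γ`: the union in `ℙ³` of all tangent lines to `Γ`. -/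
def tangentialDevelopable : Set (ℙ K (Fin 4 → K)) :=
  {P | ∃ a : Fin 2 → K, a ≠ 0 ∧ P.submodule ≤ tangentLine a}

/-- The affine plane curve `F(p + x u + y w) = 0`. When `p, u, w` are linearly independent, this is
the section of the surface `F = 0` by the plane spanned by `[p], [u], [w]`, in affine coordinates
`x, y` of that plane centred at `[p]`. -/
def planeSection (F : MvPolynomial (Fin 4) K) (p u w : Fin 4 → K) : MvPolynomial (Fin 2) K :=
  MvPolynomial.aeval
    (fun i => MvPolynomial.C (p i) + MvPolynomial.C (u i) * MvPolynomial.X 0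
      + MvPolynomial.C (w i) * MvPolynomial.X 1) F

/-- The plane curve `f = 0` has a cusp, in the broad sense, at the origin: a double point whose
tangent cone is a double line `ℓ² = 0` (over an algebraically closed field constant factors can be
absorbed in `ℓ`). -/
def IsCusp (f : MvPolynomial (Fin 2) K) : Prop :=
  f.homogeneousComponent 0 = 0 ∧ f.homogeneousComponent 1 = 0 ∧
    ∃ l : MvPolynomial (Fin 2) K, l.IsHomogeneous 1 ∧ l ≠ 0 ∧ f.homogeneousComponent 2 = l ^ 2

/-- The plane curve `f = 0` has an ordinary cusp (locally `y² = x³`) at the origin: a double point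
whose tangent cone is a double line `ℓ² = 0`, the cubic term of `f` not being divisible by `ℓ`. -/
def IsOrdinaryCusp (f : MvPolynomial (Fin 2) K) : Prop :=
  f.homogeneousComponent 0 = 0 ∧ f.homogeneousComponent 1 = 0 ∧
    ∃ l : MvPolynomial (Fin 2) K, l.IsHomogeneous 1 ∧ l ≠ 0 ∧ f.homogeneousComponent 2 = l ^ 2 ∧
      ¬ l ∣ f.homogeneousComponent 3

/-- The vectors `u, w` span, together with the point `[veronese a]` of `Γ`, a plane of `ℙ³` through
this point that is transversal to `Γ` there, i.e. does not contain the tangent line. -/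
def IsTransversalPlane (a : Fin 2 → K) (u w : Fin 4 → K) : Prop :=
  LinearIndependent K ![veronese a, u, w] ∧
    ¬ tangentLine a ≤ Submodule.span K {veronese a, u, w}

/-- `Γ` is a cuspidal curve for the surface `F = 0`: at all but finitely many points of `Γ`, the
sections of the surface by the planes transversal to `Γ` have a cusp. -/
def HasCuspidalTwistedCubic (F : MvPolynomial (Fin 4) K) : Prop :=
  ∃ E : Set (ℙ K (Fin 2 → K)), E.Finite ∧
    ∀ (a : Fin 2 → K) (ha : a ≠ 0), Projectivization.mk K a ha ∉ E →
      ∀ u w : Fin 4 → K, IsTransversalPlane a u w → IsCusp (planeSection F (veronese a) u w)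

/-- At every point of `Γ`, the sections of the surface `F = 0` by the planes transversal to `Γ` have
an ordinary cusp. -/
def HasOrdinaryCuspsAlongTwistedCubic (F : MvPolynomial (Fin 4) K) : Prop :=
  ∀ a : Fin 2 → K, a ≠ 0 →
    ∀ u w : Fin 4 → K, IsTransversalPlane a u w →
      IsOrdinaryCusp (planeSection F (veronese a) u w)

end CuspidalQuartic

end

open scoped LinearAlgebra.Projectivization

noncomputable section

namespace CuspidalQuartic

open MvPolynomial

/-! The twisted cubic Γ is cut out by the quadrics q₀, q₁, q₂ of `netQuadric`, and a quartic
singular along Γ is a ternary quadratic form c in them (`exists_eq_conicQuartic`). At a point p of Γ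
the quadrics vanish, so q(p + v) starts with the linear term `netPolar p v`, and the tangent cone of
the quartic at p is c composed with `netPolar p`.

For p = Γ(t) the values of `netPolar p` fill the plane t²y₀ - t y₁ + y₂ = 0, i.e. a line L_t of the
projective plane. The lines L_t envelop the conic y₁² = 4y₀y₂. A cusp forces c restricted to L_t to
be a square, that is, L_t to be tangent to c or to meet its vertex. If this happens for infinitely
many t, then either c is proportional to y₁² - 4y₀y₂, or c has rank at most one and the quartic is
zero or a constant times a square (`conic_discriminant_of_isCusp`,
`conicQuartic_not_irreducible_or_eq`).

Conversely q₁² - 4q₀q₂ vanishes exactly on the tangent developable, and its tangent cone at a point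
of Γ is the doubled osculating plane (`conic_netPolar_veronese`). A transversal plane meets the
osculating plane in a line other than the tangent, and along it the cubic term is nonzero
(`conicPolar_veronese`), so the cusp is ordinary. -/

/-! ### Polarisation of the net of quadrics and of ternary conics -/

/-- The three quadrics through the twisted cubic, evaluated at a vector. -/
def netQuadric {R : Type*} [CommRing R] (x : Fin 4 → R) : Fin 3 → R :=
  ![x 0 * x 2 - x 1 ^ 2, x 0 * x 3 - x 1 * x 2, x 1 * x 3 - x 2 ^ 2]

/-- The polar form of `netQuadric`. -/
def netPolar {R : Type*} [CommRing R] (p v : Fin 4 → R) : Fin 3 → R :=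
  ![p 0 * v 2 + p 2 * v 0 - 2 * p 1 * v 1, p 0 * v 3 + p 3 * v 0 - p 1 * v 2 - p 2 * v 1,
    p 1 * v 3 + p 3 * v 1 - 2 * p 2 * v 2]

/-- The ternary quadratic form with coefficients `c`. -/
def conic {R : Type*} [CommRing R] (c : Fin 6 → R) (y : Fin 3 → R) : R :=
  c 0 * y 0 ^ 2 + c 1 * (y 0 * y 1) + c 2 * y 1 ^ 2 + c 3 * (y 0 * y 2) + c 4 * (y 1 * y 2)
    + c 5 * y 2 ^ 2

/-- The polar form of `conic`. -/
def conicPolar {R : Type*} [CommRing R] (c : Fin 6 → R) (y z : Fin 3 → R) : R :=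
  2 * c 0 * (y 0 * z 0) + c 1 * (y 0 * z 1 + y 1 * z 0) + 2 * c 2 * (y 1 * z 1)
    + c 3 * (y 0 * z 2 + y 2 * z 0) + c 4 * (y 1 * z 2 + y 2 * z 1) + 2 * c 5 * (y 2 * z 2)

lemma netQuadric_add {R : Type*} [CommRing R] (p v : Fin 4 → R) :
    netQuadric (p + v) = netQuadric p + netPolar p v + netQuadric v := by
  ext i
  fin_cases i <;> simp [netQuadric, netPolar] <;> ring

lemma conic_add {R : Type*} [CommRing R] (c : Fin 6 → R) (y z : Fin 3 → R) :
    conic c (y + z) = conic c y + conicPolar c y z + conic c z := by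
  simp only [conic, conicPolar, Pi.add_apply]
  ring

lemma map_netQuadric {R S : Type*} [CommRing R] [CommRing S] (f : R →+* S) (x : Fin 4 → R)
    (i : Fin 3) : f (netQuadric x i) = netQuadric (fun j => f (x j)) i := by
  fin_cases i <;> simp [netQuadric]

lemma map_netPolar {R S : Type*} [CommRing R] [CommRing S] (f : R →+* S) (p v : Fin 4 → R)
    (i : Fin 3) : f (netPolar p v i) = netPolar (fun j => f (p j)) (fun j => f (v j)) i := by
  have h : f 2 = 2 := map_ofNat f 2
  fin_cases i <;> simp [netPolar, h]

lemma map_conic {R S : Type*} [CommRing R] [CommRing S] (f : R →+* S) (c : Fin 6 → R)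
    (y : Fin 3 → R) : f (conic c y) = conic (fun j => f (c j)) (fun j => f (y j)) := by
  simp [conic]

lemma map_conicPolar {R S : Type*} [CommRing R] [CommRing S] (f : R →+* S) (c : Fin 6 → R)
    (y z : Fin 3 → R) :
    f (conicPolar c y z) = conicPolar (fun j => f (c j)) (fun j => f (y j)) (fun j => f (z j)) := by
  have h : f 2 = 2 := map_ofNat f 2
  simp [conicPolar, h]

/-! ### Quartics in the net and their plane sections -/

variable {K : Type*} [Field K]

/-- The quartic form obtained by substituting the quadrics through the twisted cubic in a ternary
quadratic form. -/
def conicQuartic (c : Fin 6 → K) : MvPolynomial (Fin 4) K :=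
  conic (fun j => C (c j)) (netQuadric X)

lemma eval_conicQuartic (c : Fin 6 → K) (x : Fin 4 → K) :
    eval x (conicQuartic c) = conic c (netQuadric x) := by
  rw [conicQuartic, map_conic]
  simp [map_netQuadric]

lemma isHomogeneous_netQuadric {σ : Type*} {x : Fin 4 → MvPolynomial σ K}
    (hx : ∀ i, (x i).IsHomogeneous 1) (i : Fin 3) : (netQuadric x i).IsHomogeneous 2 := by
  have h (i j) : (x i * x j).IsHomogeneous 2 := (hx i).mul (hx j)
  fin_cases i
  · simpa [netQuadric, sq] using (h 0 2).sub (h 1 1)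
  · simpa [netQuadric, sq] using (h 0 3).sub (h 1 2)
  · simpa [netQuadric, sq] using (h 1 3).sub (h 2 2)

lemma isHomogeneous_netPolar {σ : Type*} (p : Fin 4 → K) {v : Fin 4 → MvPolynomial σ K}
    (hv : ∀ i, (v i).IsHomogeneous 1) (i : Fin 3) :
    (netPolar (fun i => C (p i)) v i).IsHomogeneous 1 := by
  have h (a : K) (j) : (C a * v j).IsHomogeneous 1 := (hv j).C_mul a
  have e : (C 2 : MvPolynomial σ K) = 2 := map_ofNat C 2
  fin_cases i
  · simpa [netPolar, e] using ((h (p 0) 2).add (h (p 2) 0)).sub (h (2 * p 1) 1)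
  · simpa [netPolar] using (((h (p 0) 3).add (h (p 3) 0)).sub (h (p 1) 2)).sub (h (p 2) 1)
  · simpa [netPolar, e] using ((h (p 1) 3).add (h (p 3) 1)).sub (h (2 * p 2) 2)

lemma isHomogeneous_conic {σ : Type*} (c : Fin 6 → K) {n : ℕ} {y : Fin 3 → MvPolynomial σ K}
    (hy : ∀ i, (y i).IsHomogeneous n) : (conic (fun j => C (c j)) y).IsHomogeneous (n + n) := by
  have h (a i j) : (C (c a) * (y i * y j)).IsHomogeneous (n + n) := ((hy i).mul (hy j)).C_mul _
  simpa only [conic, sq] using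
    (((((h 0 0 0).add (h 1 0 1)).add (h 2 1 1)).add (h 3 0 2)).add (h 4 1 2)).add (h 5 2 2)

lemma isHomogeneous_conicPolar {σ : Type*} (c : Fin 6 → K) {m n : ℕ}
    {y z : Fin 3 → MvPolynomial σ K} (hy : ∀ i, (y i).IsHomogeneous m)
    (hz : ∀ i, (z i).IsHomogeneous n) :
    (conicPolar (fun j => C (c j)) y z).IsHomogeneous (m + n) := by
  have h (a i j) : (C a * (y i * z j)).IsHomogeneous (m + n) := ((hy i).mul (hz j)).C_mul _
  have h2 (a i j) : (C a * (y i * z j + y j * z i)).IsHomogeneous (m + n) := by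
    rw [mul_add]
    exact (h a i j).add (h a j i)
  have e (a : K) : (2 : MvPolynomial σ K) * C a = C (2 * a) := by
    rw [C_mul]
    exact congrArg (· * C a) (map_ofNat C 2).symm
  simp only [conicPolar, e]
  exact (((((h _ 0 0).add (h2 _ 0 1)).add (h _ 1 1)).add (h2 _ 0 2)).add (h2 _ 1 2)).add (h _ 2 2)

lemma isHomogeneous_conicQuartic (c : Fin 6 → K) : (conicQuartic c).IsHomogeneous 4 :=
  isHomogeneous_conic c (n := 2) fun i => isHomogeneous_netQuadric (fun j => isHomogeneous_X K j) i

/-- The generic vector of the linear span of `u` and `w`. -/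
def genericVector (u w : Fin 4 → K) : Fin 4 → MvPolynomial (Fin 2) K :=
  fun i => C (u i) * X 0 + C (w i) * X 1

lemma isHomogeneous_genericVector (u w : Fin 4 → K) (i : Fin 4) :
    (genericVector u w i).IsHomogeneous 1 :=
  ((isHomogeneous_X K 0).C_mul _).add ((isHomogeneous_X K 1).C_mul _)

/-- Since q(p) = 0, q(p + v) has only a linear part and a quadratic part in v. Substituted in a
quadratic form, these give the parts of degree 2, 3 and 4. -/
lemma planeSection_conicQuartic (c : Fin 6 → K) {p : Fin 4 → K} (hp : netQuadric p = 0)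
    (u w : Fin 4 → K) :
    planeSection (conicQuartic c) p u w =
      conic (fun j => C (c j)) (netPolar (fun i => C (p i)) (genericVector u w))
      + conicPolar (fun j => C (c j)) (netPolar (fun i => C (p i)) (genericVector u w))
          (netQuadric (genericVector u w))
      + conic (fun j => C (c j)) (netQuadric (genericVector u w)) := by
  have hp' : netQuadric (fun i => (C (p i) : MvPolynomial (Fin 2) K)) = 0 := by
    ext1 i
    rw [← map_netQuadric, hp]
    simp
  rw [← conic_add, ← zero_add (netPolar _ _), ← hp', ← netQuadric_add]
  have e (φ : MvPolynomial (Fin 4) K →+* MvPolynomial (Fin 2) K) (hφ : ∀ a, φ (C a) = C a) :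
      φ (conicQuartic c) = conic (fun j => C (c j)) (netQuadric fun j => φ (X j)) := by
    rw [conicQuartic, map_conic]
    simp only [map_netQuadric, hφ]
  refine (e (aeval _).toRingHom fun a => by simp [algebraMap_eq]).trans ?_
  congr 2
  ext1 i
  simp [genericVector, add_assoc]

lemma homogeneousComponent_planeSection_conicQuartic (c : Fin 6 → K) {p : Fin 4 → K}
    (hp : netQuadric p = 0) (u w : Fin 4 → K) (k : ℕ) :
    homogeneousComponent k (planeSection (conicQuartic c) p u w) =
      (if k = 2 then conic (fun j => C (c j)) (netPolar (fun i => C (p i)) (genericVector u w))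
        else 0)
      + (if k = 3 then
          conicPolar (fun j => C (c j)) (netPolar (fun i => C (p i)) (genericVector u w))
            (netQuadric (genericVector u w)) else 0)
      + (if k = 4 then conic (fun j => C (c j)) (netQuadric (genericVector u w)) else 0) := by
  have hv := isHomogeneous_genericVector u w
  rw [planeSection_conicQuartic c hp, map_add, map_add,
    homogeneousComponent_of_mem (isHomogeneous_conic c (isHomogeneous_netPolar p hv)),
    homogeneousComponent_of_mem (isHomogeneous_conic c (isHomogeneous_netQuadric hv)),
    homogeneousComponent_of_mem (isHomogeneous_conicPolar c (isHomogeneous_netPolar p hv)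
      (isHomogeneous_netQuadric hv))]

/-! ### The twisted cubic and its tangent lines -/

lemma veronese_eq (a : Fin 2 → K) :
    veronese a = ![a 0 ^ 3, a 0 ^ 2 * a 1, a 0 * a 1 ^ 2, a 1 ^ 3] := by
  ext i
  fin_cases i <;> simp [veronese, veroneseForm]

lemma veroneseDeriv_zero (a : Fin 2 → K) :
    veroneseDeriv 0 a = ![3 * a 0 ^ 2, 2 * a 0 * a 1, a 1 ^ 2, 0] := by
  ext i
  fin_cases i <;> simp [veroneseDeriv, veroneseForm] <;> ring

lemma veroneseDeriv_one (a : Fin 2 → K) :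
    veroneseDeriv 1 a = ![0, a 0 ^ 2, 2 * a 0 * a 1, 3 * a 1 ^ 2] := by
  ext i
  fin_cases i <;> simp [veroneseDeriv, veroneseForm] <;> ring

lemma netQuadric_veronese (a : Fin 2 → K) : netQuadric (veronese a) = 0 := by
  ext i
  rw [veronese_eq]
  fin_cases i <;> simp [netQuadric] <;> ring

lemma mem_tangentLine {a : Fin 2 → K} {x : Fin 4 → K} :
    x ∈ tangentLine a ↔
      ∃ r s t : K, x = r • veronese a + s • veroneseDeriv 0 a + t • veroneseDeriv 1 a := by
  simp only [tangentLine, Submodule.mem_span_insert, Submodule.mem_span_range_iff_exists_fun,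
    Fin.sum_univ_two]
  constructor
  · rintro ⟨r, _, ⟨c, rfl⟩, rfl⟩
    exact ⟨r, c 0, c 1, by rw [add_assoc]⟩
  · rintro ⟨r, s, t, rfl⟩
    exact ⟨r, _, ⟨![s, t], rfl⟩, by simp [add_assoc]⟩

/-! ### The tangent developable as a zero locus -/

variable (K) in
/-- The coefficient vector of the ternary quadratic form `y₁² - 4 y₀ y₂`. -/
def discCoeff : Fin 6 → K := ![0, 0, 1, -4, 0, 0]

variable (K) in
/-- The quartic form defining the tangential developable of the twisted cubic. -/
def developableQuartic : MvPolynomial (Fin 4) K := conicQuartic (discCoeff K)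

lemma conic_discCoeff (y : Fin 3 → K) : conic (discCoeff K) y = y 1 ^ 2 - 4 * (y 0 * y 2) := by
  simp [conic, discCoeff]
  ring

lemma eval_developableQuartic (x : Fin 4 → K) :
    eval x (developableQuartic K) =
      (x 0 * x 3 - x 1 * x 2) ^ 2 - 4 * ((x 0 * x 2 - x 1 ^ 2) * (x 1 * x 3 - x 2 ^ 2)) := by
  rw [developableQuartic, eval_conicQuartic, conic_discCoeff]
  simp [netQuadric]

lemma eval_developableQuartic_of_mem_tangentLine {a : Fin 2 → K} {x : Fin 4 → K}
    (hx : x ∈ tangentLine a) : eval x (developableQuartic K) = 0 := by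
  obtain ⟨r, s, t, rfl⟩ := mem_tangentLine.1 hx
  rw [eval_developableQuartic, veronese_eq, veroneseDeriv_zero, veroneseDeriv_one]
  simp
  ring

lemma exists_mem_tangentLine (h2 : (2 : K) ≠ 0) {x : Fin 4 → K}
    (hx : eval x (developableQuartic K) = 0) : ∃ a : Fin 2 → K, a ≠ 0 ∧ x ∈ tangentLine a := by
  rw [eval_developableQuartic] at hx
  -- The two equations cut out the tangent line at Γ(t); `infty` is the case of the tangent at (0 :
  -- 1).
  have aff (t : K) (h : x 0 * t ^ 2 - 2 * t * x 1 + x 2 = 0)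
      (h' : x 1 * t ^ 2 - 2 * t * x 2 + x 3 = 0) :
      ∃ a : Fin 2 → K, a ≠ 0 ∧ x ∈ tangentLine a := by
    refine ⟨![1, t], fun e => by simpa using congrFun e 0, mem_tangentLine.2
      ⟨x 0, 0, x 1 - t * x 0, ?_⟩⟩
    rw [veronese_eq, veroneseDeriv_zero, veroneseDeriv_one]
    ext i
    fin_cases i <;> simp
    · ring
    · linear_combination h
    · linear_combination h' + 2 * t * h
  have infty (h : x 0 = 0) (h' : x 1 = 0) : ∃ a : Fin 2 → K, a ≠ 0 ∧ x ∈ tangentLine a := by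
    refine ⟨![0, 1], fun e => by simpa using congrFun e 1, mem_tangentLine.2
      ⟨x 3, x 2, 0, ?_⟩⟩
    rw [veronese_eq, veroneseDeriv_zero, veroneseDeriv_one]
    ext i
    fin_cases i <;> simp [h, h']
  -- If q₀ = 0, then q₁ = 0 too, and x lies on Γ or on the tangent at infinity.
  by_cases hq : x 0 * x 2 - x 1 ^ 2 = 0
  · have hq1 : x 0 * x 3 - x 1 * x 2 = 0 := by
      refine pow_eq_zero_iff two_ne_zero |>.1 ?_
      linear_combination hx + 4 * (x 1 * x 3 - x 2 ^ 2) * hq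
    by_cases h0 : x 0 = 0
    · refine infty h0 (pow_eq_zero_iff two_ne_zero |>.1 ?_)
      linear_combination x 2 * h0 - hq
    · have e2 : x 2 = x 1 ^ 2 / x 0 := by
        field_simp
        linear_combination hq
      have e3 : x 3 = x 1 * x 2 / x 0 := by
        field_simp
        linear_combination hq1
      refine aff (x 1 / x 0) ?_ ?_
      · rw [e2]
        field_simp
        ring
      · rw [e3, e2]
        field_simp
        ring
  -- On the tangent at Γ(t) the vector q is proportional to (1, 2t, t²), which forces t = q₁/(2q₀).
  · obtain ⟨t, ht⟩ : ∃ t, 2 * (x 0 * x 2 - x 1 ^ 2) * t = x 0 * x 3 - x 1 * x 2 :=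
      ⟨_, mul_div_cancel₀ _ (mul_ne_zero h2 hq)⟩
    have h22 : (2 * (x 0 * x 2 - x 1 ^ 2)) ^ 2 ≠ 0 := pow_ne_zero _ (mul_ne_zero h2 hq)
    refine aff t ?_ ?_ <;> refine (mul_eq_zero.1 ?_).resolve_left h22
    · linear_combination (x 0 * (2 * (x 0 * x 2 - x 1 ^ 2) * t + (x 0 * x 3 - x 1 * x 2))
        - 4 * x 1 * (x 0 * x 2 - x 1 ^ 2)) * ht + x 0 * hx
    · linear_combination (x 1 * (2 * (x 0 * x 2 - x 1 ^ 2) * t + (x 0 * x 3 - x 1 * x 2))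
        - 4 * x 2 * (x 0 * x 2 - x 1 ^ 2)) * ht + x 1 * hx

lemma zeroLocus_developableQuartic (h2 : (2 : K) ≠ 0) :
    zeroLocus (developableQuartic K) = tangentialDevelopable K := by
  ext P
  simp only [zeroLocus, tangentialDevelopable, Set.mem_ofPred_eq]
  constructor
  · intro h
    obtain ⟨a, ha, hP⟩ := exists_mem_tangentLine h2 (h P.rep (by
      rw [P.submodule_eq]
      exact Submodule.mem_span_singleton_self _))
    refine ⟨a, ha, ?_⟩
    rwa [P.submodule_eq, Submodule.span_singleton_le_iff_mem]
  · rintro ⟨a, -, h⟩ x hx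
    exact eval_developableQuartic_of_mem_tangentLine (h hx)

/-! ### Equations of osculating planes and tangent lines -/

/-- The linear form of the osculating plane of the twisted cubic. -/
def osculatingForm (a : Fin 2 → K) : (Fin 4 → K) →ₗ[K] K :=
  a 0 ^ 3 • LinearMap.proj 3 - (3 * a 0 ^ 2 * a 1) • LinearMap.proj 2
    + (3 * a 0 * a 1 ^ 2) • LinearMap.proj 1 - a 1 ^ 3 • LinearMap.proj 0

lemma osculatingForm_apply (a : Fin 2 → K) (v : Fin 4 → K) :
    osculatingForm a v = a 0 ^ 3 * v 3 - 3 * a 0 ^ 2 * a 1 * v 2 + 3 * a 0 * a 1 ^ 2 * v 1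
      - a 1 ^ 3 * v 0 := rfl

/-- The pair of linear forms defining the tangent line of the twisted cubic. -/
def tangentForms (a : Fin 2 → K) : (Fin 4 → K) →ₗ[K] (Fin 2 → K) :=
  LinearMap.pi
    ![a 0 ^ 2 • LinearMap.proj 2 - (2 * a 0 * a 1) • LinearMap.proj 1 + a 1 ^ 2 • LinearMap.proj 0,
      a 0 ^ 2 • LinearMap.proj 3 - (2 * a 0 * a 1) • LinearMap.proj 2 + a 1 ^ 2 • LinearMap.proj 1]

lemma tangentForms_apply (a : Fin 2 → K) (v : Fin 4 → K) :
    tangentForms a v =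
      ![a 0 ^ 2 * v 2 - 2 * a 0 * a 1 * v 1 + a 1 ^ 2 * v 0,
        a 0 ^ 2 * v 3 - 2 * a 0 * a 1 * v 2 + a 1 ^ 2 * v 1] := by
  ext i
  fin_cases i <;> rfl

lemma apply_ne_zero {a : Fin 2 → K} (ha : a ≠ 0) : a 0 ≠ 0 ∨ a 1 ≠ 0 := by
  by_contra! h
  exact ha (funext fun i => by fin_cases i; exacts [h.1, h.2])

lemma tangentLine_le_ker_osculatingForm (a : Fin 2 → K) :
    tangentLine a ≤ LinearMap.ker (osculatingForm a) := by
  intro x hx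
  obtain ⟨r, s, t, rfl⟩ := mem_tangentLine.1 hx
  rw [LinearMap.mem_ker, osculatingForm_apply, veronese_eq, veroneseDeriv_zero, veroneseDeriv_one]
  simp
  ring

lemma tangentLine_le_ker_tangentForms (a : Fin 2 → K) :
    tangentLine a ≤ LinearMap.ker (tangentForms a) := by
  intro x hx
  obtain ⟨r, s, t, rfl⟩ := mem_tangentLine.1 hx
  rw [LinearMap.mem_ker, tangentForms_apply, veronese_eq, veroneseDeriv_zero, veroneseDeriv_one]
  ext i
  fin_cases i <;> simp <;> ring

lemma veronese_mem_tangentLine (a : Fin 2 → K) : veronese a ∈ tangentLine a :=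
  Submodule.subset_span (Set.mem_insert _ _)

lemma osculatingForm_ne_zero {a : Fin 2 → K} (ha : a ≠ 0) : osculatingForm a ≠ 0 := by
  intro h
  rcases apply_ne_zero ha with h0 | h1
  · have := LinearMap.congr_fun h (Pi.single 3 1)
    simp [osculatingForm_apply, h0] at this
  · have := LinearMap.congr_fun h (Pi.single 0 1)
    simp [osculatingForm_apply, h1] at this

lemma tangentForms_surjective {a : Fin 2 → K} (ha : a ≠ 0) :
    Function.Surjective (tangentForms a) := by
  intro y
  rcases apply_ne_zero ha with h0 | h1
  · refine ⟨![0, 0, y 0 / a 0 ^ 2, (y 1 + 2 * a 0 * a 1 * (y 0 / a 0 ^ 2)) / a 0 ^ 2], ?_⟩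
    rw [tangentForms_apply]
    ext i
    fin_cases i <;> simp <;> field_simp
    ring
  · refine ⟨![(y 0 + 2 * a 0 * a 1 * (y 1 / a 1 ^ 2)) / a 1 ^ 2, y 1 / a 1 ^ 2, 0, 0], ?_⟩
    rw [tangentForms_apply]
    ext i
    fin_cases i <;> simp <;> field_simp
    ring

lemma finrank_ker_osculatingForm {a : Fin 2 → K} (ha : a ≠ 0) :
    Module.finrank K (LinearMap.ker (osculatingForm a)) = 3 := by
  have h := LinearMap.finrank_range_add_finrank_ker (osculatingForm a)
  rw [LinearMap.range_eq_top.2 (LinearMap.surjective (osculatingForm_ne_zero ha)), finrank_top] at h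
  simp at h
  omega

lemma finrank_ker_tangentForms {a : Fin 2 → K} (ha : a ≠ 0) :
    Module.finrank K (LinearMap.ker (tangentForms a)) = 2 := by
  have h := LinearMap.finrank_range_add_finrank_ker (tangentForms a)
  rw [LinearMap.range_eq_top.2 (tangentForms_surjective ha), finrank_top] at h
  simp at h
  omega

/-- Otherwise the plane would be the osculating plane, by dimension, and this contains the tangent
line. -/
lemma IsTransversalPlane.osculatingForm_ne_zero {a : Fin 2 → K} (ha : a ≠ 0) {u w : Fin 4 → K}
    (h : IsTransversalPlane a u w) : osculatingForm a u ≠ 0 ∨ osculatingForm a w ≠ 0 := by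
  by_contra! hc
  refine h.2 ?_
  have hle : Submodule.span K {veronese a, u, w} ≤ LinearMap.ker (osculatingForm a) := by
    rw [Submodule.span_le]
    rintro x (rfl | rfl | rfl)
    exacts [tangentLine_le_ker_osculatingForm a (veronese_mem_tangentLine a), hc.1, hc.2]
  have hr : Module.finrank K (Submodule.span K {veronese a, u, w}) = 3 := by
    rw [← Set.singleton_union, ← Set.singleton_union, ← Set.union_empty {w},
      ← Matrix.range_empty ![], ← Matrix.range_cons, ← Matrix.range_cons, ← Matrix.range_cons]
    exact finrank_span_eq_card h.1
  rw [Submodule.eq_of_le_of_finrank_eq hle (hr.trans (finrank_ker_osculatingForm ha).symm)]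
  exact tangentLine_le_ker_osculatingForm a

/-- Otherwise the point and this direction would span the full kernel of `tangentForms a`, putting
the tangent line inside the plane. Comparing with the kernel avoids computing the dimension of
`tangentLine a`. -/
lemma IsTransversalPlane.tangentForms_ne_zero {a : Fin 2 → K} (ha : a ≠ 0) {u w : Fin 4 → K}
    (h : IsTransversalPlane a u w) {r s : K} (hrs : r ≠ 0 ∨ s ≠ 0) :
    tangentForms a (r • u + s • w) ≠ 0 := by
  intro hc
  refine h.2 ?_
  have hli : LinearIndependent K ![veronese a, r • u + s • w] := by
    rw [LinearIndependent.pair_iff]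
    intro x y hxy
    have := Fintype.linearIndependent_iff.1 h.1 ![x, y * r, y * s] (by
      rw [← hxy]
      simp [Fin.sum_univ_three, smul_smul, add_assoc])
    have h0 := this 0
    have h1 := this 1
    have h2 := this 2
    simp only [Matrix.cons_val] at h0 h1 h2
    refine ⟨h0, ?_⟩
    rcases hrs with hr | hs
    · exact (mul_eq_zero.1 h1).resolve_right hr
    · exact (mul_eq_zero.1 h2).resolve_right hs
  have hle : Submodule.span K {veronese a, r • u + s • w} ≤ LinearMap.ker (tangentForms a) := by
    rw [Submodule.span_le]
    rintro x (rfl | rfl)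
    exacts [tangentLine_le_ker_tangentForms a (veronese_mem_tangentLine a), hc]
  have hr : Module.finrank K (Submodule.span K {veronese a, r • u + s • w}) = 2 := by
    rw [← Set.singleton_union, ← Set.union_empty {_ + _}, ← Matrix.range_empty ![],
      ← Matrix.range_cons, ← Matrix.range_cons]
    exact finrank_span_eq_card hli
  refine (tangentLine_le_ker_tangentForms a).trans ?_
  rw [← Submodule.eq_of_le_of_finrank_eq hle (hr.trans (finrank_ker_tangentForms ha).symm),
    Submodule.span_le]
  rintro x (rfl | rfl)
  · exact Submodule.subset_span (by simp)
  · exact add_mem (Submodule.smul_mem _ _ (Submodule.subset_span (by simp)))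
      (Submodule.smul_mem _ _ (Submodule.subset_span (by simp)))

/-! ### Ordinary cusps of the developable -/

lemma conic_netPolar_veronese (a : Fin 2 → K) (u w : Fin 4 → K) :
    conic (fun j => C (discCoeff K j))
        (netPolar (fun i => C (veronese a i)) (genericVector u w)) =
      (C (osculatingForm a u) * X 0 + C (osculatingForm a w) * X 1) ^ 2 := by
  have e2 : (C 2 : MvPolynomial (Fin 2) K) = 2 := map_ofNat C 2
  have e3 : (C 3 : MvPolynomial (Fin 2) K) = 3 := map_ofNat C 3
  have e4 : (C 4 : MvPolynomial (Fin 2) K) = 4 := map_ofNat C 4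
  simp [conic, discCoeff, netPolar, genericVector, veronese_eq, osculatingForm_apply, e3, e4]
  ring

/-- The osculating form is a₀f₁ - a₁f₀, where (f₀, f₁) is the value of `tangentForms`; its vanishing
makes (f₀, f₁) a multiple m of a. At a = (1, 0) one has v₃ = 0, m = v₂, and the cubic term is -4 ·
v₂ · (-v₂²) = 4m³. -/
lemma conicPolar_veronese {a : Fin 2 → K} (ha : a ≠ 0) {v : Fin 4 → K}
    (hv : osculatingForm a v = 0) :
    ∃ m, conicPolar (discCoeff K) (netPolar (veronese a) v) (netQuadric v) = 4 * m ^ 3 ∧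
      tangentForms a v = m • a := by
  rw [osculatingForm_apply] at hv
  obtain ⟨m, h0, h1⟩ : ∃ m, a 0 ^ 2 * v 2 - 2 * a 0 * a 1 * v 1 + a 1 ^ 2 * v 0 = m * a 0 ∧
      a 0 ^ 2 * v 3 - 2 * a 0 * a 1 * v 2 + a 1 ^ 2 * v 1 = m * a 1 := by
    rcases apply_ne_zero ha with h | h
    · refine ⟨_, (div_mul_cancel₀ _ h).symm, ?_⟩
      field_simp
      linear_combination hv
    · refine ⟨_, ?_, (div_mul_cancel₀ _ h).symm⟩
      field_simp
      linear_combination -hv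
  have key : a 0 * a 1 * (v 0 * v 3 - v 1 * v 2) - a 0 ^ 2 * (v 1 * v 3 - v 2 ^ 2)
      - a 1 ^ 2 * (v 0 * v 2 - v 1 ^ 2) = m ^ 2 := by
    rcases apply_ne_zero ha with h | h
    · refine mul_left_cancel₀ (pow_ne_zero 2 h) ?_
      linear_combination -(a 0 * v 1 - a 1 * v 0) * hv
        + (a 0 ^ 2 * v 2 - 2 * a 0 * a 1 * v 1 + a 1 ^ 2 * v 0 + m * a 0) * h0
    · refine mul_left_cancel₀ (pow_ne_zero 2 h) ?_
      linear_combination (a 1 * v 2 - a 0 * v 3) * hv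
        + (a 0 ^ 2 * v 3 - 2 * a 0 * a 1 * v 2 + a 1 ^ 2 * v 1 + m * a 1) * h1
  refine ⟨m, ?_, ?_⟩
  · simp [conicPolar, discCoeff, netPolar, netQuadric, veronese_eq]
    linear_combination 4 * m * key + (2 * a 1 * (v 0 * v 3 - v 1 * v 2)
      - 4 * a 0 * (v 1 * v 3 - v 2 ^ 2)) * h0 + (2 * a 0 * (v 0 * v 3 - v 1 * v 2)
      - 4 * a 1 * (v 0 * v 2 - v 1 ^ 2)) * h1
  · rw [tangentForms_apply, h0, h1]
    ext i
    fin_cases i <;> rfl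

lemma hasOrdinaryCusps_developableQuartic (h2 : (2 : K) ≠ 0) :
    HasOrdinaryCuspsAlongTwistedCubic (developableQuartic K) := by
  intro a ha u w h
  simp only [IsOrdinaryCusp, developableQuartic,
    homogeneousComponent_planeSection_conicQuartic _ (netQuadric_veronese a)]
  refine ⟨by simp, by simp, C (osculatingForm a u) * X 0 + C (osculatingForm a w) * X 1,
    ((isHomogeneous_X K 0).C_mul _).add ((isHomogeneous_X K 1).C_mul _), ?_, ?_, ?_⟩
  · intro e
    rcases h.osculatingForm_ne_zero ha with h0 | h0 <;> refine h0 ?_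
    · simpa using congrArg (eval ![1, 0]) e
    · simpa using congrArg (eval ![0, 1]) e
  · simpa using conic_netPolar_veronese a u w
  · intro hd
    -- Evaluation at the zero of ℓ, i.e. in the direction where the section meets the osculating
    -- plane: divisibility would kill the cubic term there.
    have hd := map_dvd (eval ![osculatingForm a w, -osculatingForm a u]) hd
    have hv : (fun i => eval ![osculatingForm a w, -osculatingForm a u] (genericVector u w i)) =
        osculatingForm a w • u + -osculatingForm a u • w := by
      ext i
      simp [genericVector]
      ring
    obtain ⟨m, hm, hm'⟩ := conicPolar_veronese ha
      (v := osculatingForm a w • u + -osculatingForm a u • w) (by simp; ring)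
    have e : eval ![osculatingForm a w, -osculatingForm a u]
        (C (osculatingForm a u) * X 0 + C (osculatingForm a w) * X 1) = 0 := by
      simp
      ring
    rw [e, zero_dvd_iff] at hd
    have h4 : (4 : K) ≠ 0 := by
      have := mul_ne_zero h2 h2
      norm_num at this ⊢
      exact this
    have hm0 : m = 0 := (pow_eq_zero_iff three_ne_zero).1 <|
      (mul_eq_zero.1 <| hm.symm.trans <| by
        simpa [map_conicPolar, map_netPolar, map_netQuadric, hv] using hd).resolve_left h4
    refine h.tangentForms_ne_zero ha ?_ (hm'.trans (by rw [hm0, zero_smul]))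
    rcases h.osculatingForm_ne_zero ha with h0 | h0
    · exact Or.inr (neg_ne_zero.2 h0)
    · exact Or.inl h0

lemma HasOrdinaryCuspsAlongTwistedCubic.hasCuspidalTwistedCubic {F : MvPolynomial (Fin 4) K}
    (hF : HasOrdinaryCuspsAlongTwistedCubic F) : HasCuspidalTwistedCubic F := by
  refine ⟨∅, Set.finite_empty, fun a ha _ u w h => ?_⟩
  obtain ⟨h0, h1, l, hl, hl0, e, -⟩ := hF a ha u w h
  exact ⟨h0, h1, l, hl, hl0, e⟩

/-! ### Irreducibility of the developable quartic -/

/-- A primitive quadratic polynomial over a domain is irreducible if its discriminant is not a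
square. -/
lemma irreducible_quadratic {R : Type*} [CommRing R] [IsDomain R] {a b c : R} (ha : a ≠ 0)
    (hprim : ∀ r, r ∣ a → r ∣ b → r ∣ c → IsUnit r) (hdisc : ¬ IsSquare (b ^ 2 - 4 * a * c)) :
    Irreducible (Polynomial.C a * Polynomial.X ^ 2 + Polynomial.C b * Polynomial.X
      + Polynomial.C c) := by
  set f := Polynomial.C a * Polynomial.X ^ 2 + Polynomial.C b * Polynomial.X
    + Polynomial.C c with hf
  have hdeg : f.natDegree = 2 := Polynomial.natDegree_quadratic ha
  have hf0 : f ≠ 0 := fun h => by simp [h] at hdeg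
  have hcoeff (a b c : R) : ∀ g, g = Polynomial.C a * Polynomial.X ^ 2
      + Polynomial.C b * Polynomial.X + Polynomial.C c →
      g.coeff 0 = c ∧ g.coeff 1 = b ∧ g.coeff 2 = a := by
    rintro _ rfl
    exact ⟨by simp, by simp [Polynomial.coeff_C], by simp⟩
  obtain ⟨f0, f1, f2⟩ := hcoeff a b c f hf
  have hconst (g h : Polynomial R) (hgh : f = g * h) (hg : g.natDegree = 0) : IsUnit g := by
    obtain ⟨r, rfl⟩ := Polynomial.natDegree_eq_zero.1 hg
    have hr (i) : r ∣ f.coeff i := ⟨h.coeff i, by rw [hgh, Polynomial.coeff_C_mul]⟩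
    exact Polynomial.isUnit_C.2 (hprim r (f2 ▸ hr 2) (f1 ▸ hr 1) (f0 ▸ hr 0))
  refine ⟨fun hu => ?_, fun g h hgh => ?_⟩
  · have := Polynomial.natDegree_eq_zero_of_isUnit hu
    omega
  · have hg0 : g ≠ 0 := by
      rintro rfl
      simp [hgh] at hf0
    have hh0 : h ≠ 0 := by
      rintro rfl
      simp [hgh] at hf0
    have hsum := Polynomial.natDegree_mul hg0 hh0
    rw [← hgh, hdeg] at hsum
    by_cases hg : g.natDegree = 0
    · exact Or.inl (hconst g h hgh hg)
    by_cases hh : h.natDegree = 0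
    · exact Or.inr (hconst h g (hgh.trans (mul_comm g h)) hh)
    refine absurd ?_ hdisc
    rw [Polynomial.eq_X_add_C_of_natDegree_le_one (p := g) (by omega),
      Polynomial.eq_X_add_C_of_natDegree_le_one (p := h) (by omega)] at hgh
    have e : f = Polynomial.C (g.coeff 1 * h.coeff 1) * Polynomial.X ^ 2
        + Polynomial.C (g.coeff 1 * h.coeff 0 + g.coeff 0 * h.coeff 1) * Polynomial.X
        + Polynomial.C (g.coeff 0 * h.coeff 0) := by
      rw [hgh]
      simp only [map_mul, map_add]
      ring
    obtain ⟨e0, e1, e2⟩ := hcoeff _ _ _ f e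
    -- The discriminant of a product of two linear factors is the square of their resultant.
    refine ⟨g.coeff 1 * h.coeff 0 - g.coeff 0 * h.coeff 1, ?_⟩
    rw [← f0, ← f1, ← f2, e0, e1, e2]
    ring

/-- The form is quadratic in x₀ with leading coefficient x₃². Below, `X 0`, `X 1`, `X 2` stand for
x₁, x₂, x₃. -/
lemma irreducible_developableQuartic (h2 : (2 : K) ≠ 0) : Irreducible (developableQuartic K) := by
  have h4 : (4 : K) ≠ 0 := by
    have := mul_ne_zero h2 h2
    norm_num at this ⊢
    exact this
  have h16 : (16 : K) ≠ 0 := by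
    have := mul_ne_zero h4 h4
    norm_num at this ⊢
    exact this
  have e : finSuccEquiv K 3 (developableQuartic K) =
      Polynomial.C (X 2 ^ 2) * Polynomial.X ^ 2
        + Polynomial.C (4 * X 1 ^ 3 - 6 * X 0 * X 1 * X 2) * Polynomial.X
        + Polynomial.C (4 * X 0 ^ 3 * X 2 - 3 * X 0 ^ 2 * X 1 ^ 2) := by
    have e1 : finSuccEquiv K 3 (X 1) = Polynomial.C (X 0) := finSuccEquiv_X_succ (j := 0)
    have e2 : finSuccEquiv K 3 (X 2) = Polynomial.C (X 1) := finSuccEquiv_X_succ (j := 1)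
    have e3 : finSuccEquiv K 3 (X 3) = Polynomial.C (X 2) := finSuccEquiv_X_succ (j := 2)
    have e4 : (C 4 : MvPolynomial (Fin 4) K) = 4 := map_ofNat C 4
    have e5 : finSuccEquiv K 3 4 = 4 := map_ofNat _ 4
    have d (n : ℕ) [n.AtLeastTwo] : Polynomial.C (OfNat.ofNat n : MvPolynomial (Fin 3) K) =
      OfNat.ofNat n := map_ofNat _ n
    simp [developableQuartic, conicQuartic, conic, discCoeff, netQuadric, finSuccEquiv_X_zero, e1,
      e2, e3, e4, e5, d]
    ring
  refine (MulEquiv.irreducible_iff (finSuccEquiv K 3)).1 ?_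
  rw [e]
  refine irreducible_quadratic (pow_ne_zero _ (X_ne_zero _)) (fun r ha hb _ => ?_) ?_
  · obtain ⟨i, -, hi⟩ := (dvd_prime_pow (X_prime (R := K) (i := (2 : Fin 3))) 2).1 ha
    rcases i with _ | i
    · rw [pow_zero] at hi
      exact hi.symm.isUnit isUnit_one
    -- At (0, 1, 0) the variable x₃ vanishes while the middle coefficient equals 4.
    · have := map_dvd (eval ![(0 : K), 1, 0])
        (((dvd_pow_self (X 2) i.succ_ne_zero).trans hi.symm.dvd).trans hb)
      simp [h4] at this
  · rintro ⟨s, hs⟩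
    -- At (T, 0, -1) the discriminant becomes 16T³, of odd degree.
    have := congrArg (fun p => (aeval ![Polynomial.X, (0 : Polynomial K), -1] p).natDegree) hs
    simp at this
    have d : (4 * (4 * Polynomial.X ^ 3) : Polynomial K) = Polynomial.C 16 * Polynomial.X ^ 3 := by
      rw [← map_ofNat Polynomial.C 4, ← mul_assoc, ← map_mul]
      norm_num
    rw [d, Polynomial.natDegree_C_mul_X_pow _ _ h16, ← sq, Polynomial.natDegree_pow] at this
    omega

/-! ### From cuspidal sections to vanishing of derivatives along Γ -/

lemma coeff_eq_zero_of_infinite {n : ℕ} {S : Set K} (hS : S.Infinite) {f : Fin n → K}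
    (h : ∀ t ∈ S, ∑ i, f i * t ^ (i : ℕ) = 0) : f = 0 := by
  have h0 : ∑ i, Polynomial.C (f i) * Polynomial.X ^ (i : ℕ) = 0 := by
    refine Polynomial.eq_zero_of_infinite_isRoot _ (hS.mono fun t ht => ?_)
    simpa [Polynomial.IsRoot, Polynomial.eval_finsetSum] using h t ht
  ext i
  have := congrArg (fun p => Polynomial.coeff p i) h0
  simpa [Polynomial.finsetSum_coeff, Polynomial.coeff_X_pow, Fin.ext_iff.symm] using this

lemma eval_pderiv_planeSection (F : MvPolynomial (Fin 4) K) (p : Fin 4 → K) (u w : Fin 4 → K) :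
    eval 0 (planeSection F p u w) = eval p F ∧
    eval 0 (pderiv 0 (planeSection F p u w)) = ∑ i, u i * eval p (pderiv i F) ∧
    eval 0 (pderiv 1 (planeSection F p u w)) = ∑ i, w i * eval p (pderiv i F) := by
  induction F using MvPolynomial.induction_on with
  | C a => simp [planeSection, algebraMap_eq]
  | add f g hf hg =>
    simp only [planeSection, map_add, mul_add, Finset.sum_add_distrib] at *
    exact ⟨by rw [hf.1, hg.1], by rw [hf.2.1, hg.2.1], by rw [hf.2.2, hg.2.2]⟩
  | mul_X f i hf =>
    simp only [planeSection, map_mul, pderiv_mul, map_add, mul_add, Finset.sum_add_distrib] at *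
    have hs (v : Fin 4 → K) : ∑ j, v j * (p i * eval p (pderiv j f))
        = p i * ∑ j, v j * eval p (pderiv j f) := by
      rw [Finset.mul_sum]
      exact Finset.sum_congr rfl fun _ _ => mul_left_comm _ _ _
    have hd (v : Fin 4 → K) : ∑ j, v j * (eval p f * eval p (pderiv j (X i))) = eval p f * v i := by
      rw [Finset.sum_eq_single i]
      · simp [mul_comm]
      · intro j _ hj
        simp [pderiv_X_of_ne hj.symm]
      · simp
    simp only [hf, hd, aeval_X]
    simp [mul_comm, hs]

lemma eval_eq_zero_of_homogeneousComponent {σ : Type*} {f : MvPolynomial σ K}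
    (h : homogeneousComponent 0 f = 0) : eval 0 f = 0 := by
  rw [homogeneousComponent_zero, C_eq_zero] at h
  rw [eval_zero, constantCoeff_eq, h]

lemma eval_pderiv_eq_zero_of_homogeneousComponent {σ : Type*} {f : MvPolynomial σ K} (i : σ)
    (h : homogeneousComponent 1 f = 0) : eval 0 (pderiv i f) = 0 := by
  have := congrArg (coeff (Finsupp.single i 1)) h
  rw [coeff_homogeneousComponent] at this
  rw [eval_zero, constantCoeff_eq, coeff_pderiv]
  simpa using this

lemma eq_sum_antidiagonalTuple_of_isHomogeneous {n d : ℕ} {F : MvPolynomial (Fin n) K}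
    (hF : F.IsHomogeneous d) :
    F = ∑ s ∈ Finset.Nat.antidiagonalTuple n d,
      C (coeff (Finsupp.equivFunOnFinite.symm s) F) * ∏ i, X i ^ s i := by
  have hm (s : Fin n → ℕ) : C (coeff (Finsupp.equivFunOnFinite.symm s) F) * ∏ i, X i ^ s i =
      monomial (Finsupp.equivFunOnFinite.symm s) (coeff (Finsupp.equivFunOnFinite.symm s) F) := by
    rw [monomial_eq, Finsupp.prod_fintype _ _ (by simp)]
    simp
  simp only [hm]
  ext m
  rw [coeff_sum]
  simp only [coeff_monomial]
  by_cases hd : ∑ i, m i = d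
  · rw [Finset.sum_eq_single (m : Fin n → ℕ)]
    · simp
    · intro s _ hs
      rw [if_neg]
      rintro rfl
      simp at hs
    · intro h
      exact absurd (Finset.Nat.mem_antidiagonalTuple.2 hd) h
  · rw [Finset.sum_eq_zero]
    · refine hF.coeff_eq_zero ?_
      rwa [Finsupp.degree_eq_sum]
    · intro s hs
      rw [if_neg]
      rintro rfl
      exact hd (Finset.Nat.mem_antidiagonalTuple.1 hs)

/-- The plane is x₁ = t x₀, and the derivative of Γ at t violates this equation. For uniqueness this
single plane at each point is enough. -/
lemma isTransversalPlane_affine (t : K) :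
    IsTransversalPlane ![1, t] ![0, 0, 1, 0] ![0, 0, 0, 1] := by
  have hmem : ∀ x ∈ Submodule.span K {veronese ![1, t], ![0, 0, 1, 0], ![0, 0, 0, 1]},
      x 1 = t * x 0 := by
    intro x hx
    induction hx using Submodule.span_induction with
    | mem x hx => rcases hx with rfl | rfl | rfl <;> simp [veronese_eq]
    | zero => simp
    | add x y _ _ hx hy => simp [hx, hy, mul_add]
    | smul r x _ hx => simp [hx, mul_left_comm]
  constructor
  · rw [Fintype.linearIndependent_iff]
    intro g hg
    rw [Fin.sum_univ_three, veronese_eq] at hg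
    have h0 := congrFun hg 0
    have h2 := congrFun hg 2
    have h3 := congrFun hg 3
    simp at h0 h2 h3
    simp [h0] at h2 h3
    intro i
    fin_cases i
    exacts [h0, h2, h3]
  · intro h
    have := hmem _ (h (mem_tangentLine.2 ⟨0, 0, 1, rfl⟩))
    simp [veronese_eq, veroneseDeriv_zero, veroneseDeriv_one] at this

lemma infinite_affine_parameter [Infinite K] {E : Set (ℙ K (Fin 2 → K))} (hE : E.Finite) :
    {t : K | ∃ h : ![1, t] ≠ 0, Projectivization.mk K ![1, t] h ∉ E}.Infinite := by
  have h1 (t : K) : ![1, t] ≠ 0 := fun e => by simpa using congrFun e 0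
  have hinj : Function.Injective fun t : K => Projectivization.mk K ![1, t] (h1 t) := by
    intro s t hst
    obtain ⟨a, ha⟩ := (Projectivization.mk_eq_mk_iff' K _ _ _ _).1 hst
    have e0 := congrFun ha 0
    have e1 := congrFun ha 1
    simp at e0 e1
    simpa [e0] using e1.symm
  refine (hE.preimage hinj.injOn).infinite_compl.mono fun t ht => ⟨h1 t, ht⟩

/-! ### Quartics singular along Γ -/

lemma exists_quaternary_quartic_of_isHomogeneous {F : MvPolynomial (Fin 4) K}
    (hF : F.IsHomogeneous 4) : ∃ c : ℕ → ℕ → ℕ → ℕ → K, F =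
      C (c 4 0 0 0) * (X 0 ^ 4) + C (c 3 1 0 0) * (X 0 ^ 3 * X 1)
      + C (c 3 0 1 0) * (X 0 ^ 3 * X 2) + C (c 3 0 0 1) * (X 0 ^ 3 * X 3)
      + C (c 2 2 0 0) * (X 0 ^ 2 * X 1 ^ 2) + C (c 2 1 1 0) * (X 0 ^ 2 * X 1 * X 2)
      + C (c 2 1 0 1) * (X 0 ^ 2 * X 1 * X 3) + C (c 2 0 2 0) * (X 0 ^ 2 * X 2 ^ 2)
      + C (c 2 0 1 1) * (X 0 ^ 2 * X 2 * X 3) + C (c 2 0 0 2) * (X 0 ^ 2 * X 3 ^ 2)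
      + C (c 1 3 0 0) * (X 0 * X 1 ^ 3) + C (c 1 2 1 0) * (X 0 * X 1 ^ 2 * X 2)
      + C (c 1 2 0 1) * (X 0 * X 1 ^ 2 * X 3) + C (c 1 1 2 0) * (X 0 * X 1 * X 2 ^ 2)
      + C (c 1 1 1 1) * (X 0 * X 1 * X 2 * X 3) + C (c 1 1 0 2) * (X 0 * X 1 * X 3 ^ 2)
      + C (c 1 0 3 0) * (X 0 * X 2 ^ 3) + C (c 1 0 2 1) * (X 0 * X 2 ^ 2 * X 3)
      + C (c 1 0 1 2) * (X 0 * X 2 * X 3 ^ 2) + C (c 1 0 0 3) * (X 0 * X 3 ^ 3)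
      + C (c 0 4 0 0) * (X 1 ^ 4) + C (c 0 3 1 0) * (X 1 ^ 3 * X 2)
      + C (c 0 3 0 1) * (X 1 ^ 3 * X 3) + C (c 0 2 2 0) * (X 1 ^ 2 * X 2 ^ 2)
      + C (c 0 2 1 1) * (X 1 ^ 2 * X 2 * X 3) + C (c 0 2 0 2) * (X 1 ^ 2 * X 3 ^ 2)
      + C (c 0 1 3 0) * (X 1 * X 2 ^ 3) + C (c 0 1 2 1) * (X 1 * X 2 ^ 2 * X 3)
      + C (c 0 1 1 2) * (X 1 * X 2 * X 3 ^ 2) + C (c 0 1 0 3) * (X 1 * X 3 ^ 3)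
      + C (c 0 0 4 0) * (X 2 ^ 4) + C (c 0 0 3 1) * (X 2 ^ 3 * X 3)
      + C (c 0 0 2 2) * (X 2 ^ 2 * X 3 ^ 2) + C (c 0 0 1 3) * (X 2 * X 3 ^ 3)
      + C (c 0 0 0 4) * (X 3 ^ 4) := by
  refine ⟨fun i j k l => coeff (Finsupp.equivFunOnFinite.symm ![i, j, k, l]) F, ?_⟩
  have e : List.Nat.antidiagonalTuple 4 4 = [
        ![0, 0, 0, 4], ![0, 0, 1, 3], ![0, 0, 2, 2], ![0, 0, 3, 1], ![0, 0, 4, 0], ![0, 1, 0, 3],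
        ![0, 1, 1, 2], ![0, 1, 2, 1], ![0, 1, 3, 0], ![0, 2, 0, 2], ![0, 2, 1, 1], ![0, 2, 2, 0],
        ![0, 3, 0, 1], ![0, 3, 1, 0], ![0, 4, 0, 0], ![1, 0, 0, 3], ![1, 0, 1, 2], ![1, 0, 2, 1],
        ![1, 0, 3, 0], ![1, 1, 0, 2], ![1, 1, 1, 1], ![1, 1, 2, 0], ![1, 2, 0, 1], ![1, 2, 1, 0],
        ![1, 3, 0, 0], ![2, 0, 0, 2], ![2, 0, 1, 1], ![2, 0, 2, 0], ![2, 1, 0, 1], ![2, 1, 1, 0],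
        ![2, 2, 0, 0], ![3, 0, 0, 1], ![3, 0, 1, 0], ![3, 1, 0, 0], ![4, 0, 0, 0]] := by
    decide
  conv_lhs => rw [eq_sum_antidiagonalTuple_of_isHomogeneous hF]
  change (List.map _ (List.Nat.antidiagonalTuple 4 4)).sum = _
  rw [e]
  simp only [List.map_cons, List.map_nil, List.sum_cons, List.sum_nil, Fin.prod_univ_four,
    Matrix.cons_val, pow_zero, one_mul, mul_one, pow_one, add_zero]
  ring

/-- A quartic form singular along the twisted cubic is a quadratic form in the quadrics through
the twisted cubic. -/
lemma exists_eq_conicQuartic {F : MvPolynomial (Fin 4) K} (hF : F.IsHomogeneous 4) {S : Set K}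
    (hS : S.Infinite) (hv : ∀ t ∈ S, eval (veronese ![1, t]) F = 0 ∧
      eval (veronese ![1, t]) (pderiv 2 F) = 0 ∧ eval (veronese ![1, t]) (pderiv 3 F) = 0) :
    ∃ c, F = conicQuartic c := by
  obtain ⟨c, hc⟩ := exists_quaternary_quartic_of_isHomogeneous hF
  -- Coefficients of the powers of t in F(Γ(t)): the monomial with exponents (i, j, k, l)
  -- contributes to t^(j + 2k + 3l). The derivatives ∂₂ and ∂₃ lower this weight by 2 and 3.
  have h0 := coeff_eq_zero_of_infinite hS (f := ![
      c 4 0 0 0, c 3 1 0 0, c 3 0 1 0 + c 2 2 0 0, c 3 0 0 1 + c 2 1 1 0 + c 1 3 0 0,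
      c 2 1 0 1 + c 2 0 2 0 + c 1 2 1 0 + c 0 4 0 0,
      c 2 0 1 1 + c 1 2 0 1 + c 1 1 2 0 + c 0 3 1 0,
      c 2 0 0 2 + c 1 1 1 1 + c 1 0 3 0 + c 0 3 0 1 + c 0 2 2 0,
      c 1 1 0 2 + c 1 0 2 1 + c 0 2 1 1 + c 0 1 3 0,
      c 1 0 1 2 + c 0 2 0 2 + c 0 1 2 1 + c 0 0 4 0, c 1 0 0 3 + c 0 1 1 2 + c 0 0 3 1,
      c 0 1 0 3 + c 0 0 2 2, c 0 0 1 3, c 0 0 0 4]) fun t ht => by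
    have := (hv t ht).1
    rw [hc, veronese_eq] at this
    simp at this
    simp [Fin.sum_univ_succ]
    linear_combination this
  have h2 := coeff_eq_zero_of_infinite hS (f := ![
      c 3 0 1 0, c 2 1 1 0, 2 * c 2 0 2 0 + c 1 2 1 0, c 2 0 1 1 + 2 * c 1 1 2 0 + c 0 3 1 0,
      c 1 1 1 1 + 3 * c 1 0 3 0 + 2 * c 0 2 2 0, 2 * c 1 0 2 1 + c 0 2 1 1 + 3 * c 0 1 3 0,
      c 1 0 1 2 + 2 * c 0 1 2 1 + 4 * c 0 0 4 0, c 0 1 1 2 + 3 * c 0 0 3 1, 2 * c 0 0 2 2,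
      c 0 0 1 3, 0]) fun t ht => by
    have := (hv t ht).2.1
    rw [hc, veronese_eq] at this
    simp at this
    simp [Fin.sum_univ_succ]
    linear_combination this
  have h3 := coeff_eq_zero_of_infinite hS (f := ![
      c 3 0 0 1, c 2 1 0 1, c 2 0 1 1 + c 1 2 0 1, 2 * c 2 0 0 2 + c 1 1 1 1 + c 0 3 0 1,
      2 * c 1 1 0 2 + c 1 0 2 1 + c 0 2 1 1, 2 * c 1 0 1 2 + 2 * c 0 2 0 2 + c 0 1 2 1,
      3 * c 1 0 0 3 + 2 * c 0 1 1 2 + c 0 0 3 1, 3 * c 0 1 0 3 + 2 * c 0 0 2 2, 3 * c 0 0 1 3,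
      4 * c 0 0 0 4]) fun t ht => by
    have := (hv t ht).2.2
    rw [hc, veronese_eq] at this
    simp at this
    simp [Fin.sum_univ_succ]
    linear_combination this
  -- The relations are regrouped by weight, the number after the underscore. Each weight is solved
  -- with integer combinations and no division, hence in every characteristic.
  have e0_0 : c 4 0 0 0 = 0 := congrFun h0 0
  have e0_1 : c 3 1 0 0 = 0 := congrFun h0 1
  have e0_2 : c 3 0 1 0 + c 2 2 0 0 = 0 := congrFun h0 2
  have e2_2 : c 3 0 1 0 = 0 := congrFun h2 0
  have e0_3 : c 3 0 0 1 + c 2 1 1 0 + c 1 3 0 0 = 0 := congrFun h0 3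
  have e2_3 : c 2 1 1 0 = 0 := congrFun h2 1
  have e3_3 : c 3 0 0 1 = 0 := congrFun h3 0
  have e0_4 : c 2 1 0 1 + c 2 0 2 0 + c 1 2 1 0 + c 0 4 0 0 = 0 := congrFun h0 4
  have e2_4 : 2 * c 2 0 2 0 + c 1 2 1 0 = 0 := congrFun h2 2
  have e3_4 : c 2 1 0 1 = 0 := congrFun h3 1
  have e0_5 : c 2 0 1 1 + c 1 2 0 1 + c 1 1 2 0 + c 0 3 1 0 = 0 := congrFun h0 5
  have e2_5 : c 2 0 1 1 + 2 * c 1 1 2 0 + c 0 3 1 0 = 0 := congrFun h2 3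
  have e3_5 : c 2 0 1 1 + c 1 2 0 1 = 0 := congrFun h3 2
  have e0_6 : c 2 0 0 2 + c 1 1 1 1 + c 1 0 3 0 + c 0 3 0 1 + c 0 2 2 0 = 0 := congrFun h0 6
  have e2_6 : c 1 1 1 1 + 3 * c 1 0 3 0 + 2 * c 0 2 2 0 = 0 := congrFun h2 4
  have e3_6 : 2 * c 2 0 0 2 + c 1 1 1 1 + c 0 3 0 1 = 0 := congrFun h3 3
  have e0_7 : c 1 1 0 2 + c 1 0 2 1 + c 0 2 1 1 + c 0 1 3 0 = 0 := congrFun h0 7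
  have e2_7 : 2 * c 1 0 2 1 + c 0 2 1 1 + 3 * c 0 1 3 0 = 0 := congrFun h2 5
  have e3_7 : 2 * c 1 1 0 2 + c 1 0 2 1 + c 0 2 1 1 = 0 := congrFun h3 4
  have e0_8 : c 1 0 1 2 + c 0 2 0 2 + c 0 1 2 1 + c 0 0 4 0 = 0 := congrFun h0 8
  have e2_8 : c 1 0 1 2 + 2 * c 0 1 2 1 + 4 * c 0 0 4 0 = 0 := congrFun h2 6
  have e3_8 : 2 * c 1 0 1 2 + 2 * c 0 2 0 2 + c 0 1 2 1 = 0 := congrFun h3 5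
  have e0_9 : c 1 0 0 3 + c 0 1 1 2 + c 0 0 3 1 = 0 := congrFun h0 9
  have e2_9 : c 0 1 1 2 + 3 * c 0 0 3 1 = 0 := congrFun h2 7
  have e3_9 : 3 * c 1 0 0 3 + 2 * c 0 1 1 2 + c 0 0 3 1 = 0 := congrFun h3 6
  have e0_10 : c 0 1 0 3 + c 0 0 2 2 = 0 := congrFun h0 10
  have e3_10 : 3 * c 0 1 0 3 + 2 * c 0 0 2 2 = 0 := congrFun h3 7
  have e0_11 : c 0 0 1 3 = 0 := congrFun h0 11
  have e0_12 : c 0 0 0 4 = 0 := congrFun h0 12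
  -- Each of x₁⁴, x₁³x₂, x₀²x₃², x₀x₂³, x₁x₂³, x₂⁴ occurs in exactly one of the six products of the
  -- quadrics, with coefficient 1, except -1 for x₀x₂³ in q₀q₂.
  refine ⟨![c 0 4 0 0, c 0 3 1 0, c 2 0 0 2, -c 1 0 3 0, c 0 1 3 0, c 0 0 4 0], hc.trans ?_⟩
  have s0 : c 4 0 0 0 = 0 := by linear_combination e0_0
  have s1 : c 3 1 0 0 = 0 := by linear_combination e0_1
  have s2 : c 3 0 1 0 = 0 := by linear_combination e2_2
  have s3 : c 2 2 0 0 = 0 := by linear_combination e0_2 - e2_2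
  have s4 : c 3 0 0 1 = 0 := by linear_combination e3_3
  have s5 : c 2 1 1 0 = 0 := by linear_combination e2_3
  have s6 : c 1 3 0 0 = 0 := by linear_combination e0_3 - e2_3 - e3_3
  have s7 : c 2 1 0 1 = 0 := by linear_combination e3_4
  have s8 : c 2 0 2 0 = c 0 4 0 0 := by linear_combination -e0_4 + e2_4 + e3_4
  have s9 : c 1 2 1 0 = -2 * c 0 4 0 0 := by linear_combination 2 * e0_4 - e2_4 - 2 * e3_4
  have s10 : c 2 0 1 1 = c 0 3 1 0 := by linear_combination -2 * e0_5 + e2_5 + 2 * e3_5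
  have s11 : c 1 2 0 1 = -c 0 3 1 0 := by linear_combination 2 * e0_5 - e2_5 - e3_5
  have s12 : c 1 1 2 0 = -c 0 3 1 0 := by linear_combination e0_5 - e3_5
  have s13 : c 1 1 1 1 = -2 * c 2 0 0 2 - c 1 0 3 0 := by
    linear_combination -2 * e0_6 + e2_6 + 2 * e3_6
  have s14 : c 0 3 0 1 = c 1 0 3 0 := by linear_combination 2 * e0_6 - e2_6 - e3_6
  have s15 : c 0 2 2 0 = c 2 0 0 2 - c 1 0 3 0 := by linear_combination e0_6 - e3_6
  have s16 : c 1 1 0 2 = c 0 1 3 0 := by linear_combination -e0_7 + e3_7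
  have s17 : c 1 0 2 1 = -c 0 1 3 0 := by linear_combination -2 * e0_7 + e2_7 + e3_7
  have s18 : c 0 2 1 1 = -c 0 1 3 0 := by linear_combination 4 * e0_7 - e2_7 - 2 * e3_7
  have s19 : c 1 0 1 2 = 0 := by linear_combination -4 * e0_8 + e2_8 + 2 * e3_8
  have s20 : c 0 2 0 2 = c 0 0 4 0 := by linear_combination 3 * e0_8 - e2_8 - e3_8
  have s21 : c 0 1 2 1 = -2 * c 0 0 4 0 := by linear_combination 2 * e0_8 - e3_8
  have s22 : c 1 0 0 3 = 0 := by linear_combination -5 * e0_9 + e2_9 + 2 * e3_9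
  have s23 : c 0 1 1 2 = 0 := by linear_combination 9 * e0_9 - 2 * e2_9 - 3 * e3_9
  have s24 : c 0 0 3 1 = 0 := by linear_combination -3 * e0_9 + e2_9 + e3_9
  have s25 : c 0 1 0 3 = 0 := by linear_combination -2 * e0_10 + e3_10
  have s26 : c 0 0 2 2 = 0 := by linear_combination 3 * e0_10 - e3_10
  have s27 : c 0 0 1 3 = 0 := by linear_combination e0_11
  have s28 : c 0 0 0 4 = 0 := by linear_combination e0_12
  rw [s0, s1, s2, s3, s4, s5, s6, s7, s8, s9, s10, s11, s12, s13, s14, s15, s16, s17, s18, s19,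
    s20, s21, s22, s23, s24, s25, s26, s27, s28]
  have two : (C 2 : MvPolynomial (Fin 4) K) = 2 := map_ofNat C 2
  simp [conicQuartic, conic, netQuadric, two]
  ring

/-! ### Conics tangent to every line L_t, and uniqueness -/

/-- The hypotheses say that the adjugate matrix of c is a multiple of that of y₁² - 4y₀y₂. If c₀ or
c₅ is nonzero, the 2×2 minors vanish and completing the square makes c a constant times the square
of a linear form. If both are zero, only c₂y₁² + c₃y₀y₂ with c₃ = 0 or c₃ = -4c₂ remains. -/
lemma conicQuartic_not_irreducible_or_eq (h2 : (2 : K) ≠ 0) (c : Fin 6 → K)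
    (e0 : c 1 ^ 2 - 4 * c 0 * c 2 = 0) (e1 : c 1 * c 3 - 2 * c 0 * c 4 = 0)
    (e2 : c 3 ^ 2 - 2 * c 1 * c 4 - 4 * c 0 * c 5 + 4 * c 3 * c 2 = 0)
    (e3 : c 3 * c 4 - 2 * c 1 * c 5 = 0) (e4 : c 4 ^ 2 - 4 * c 2 * c 5 = 0) :
    ¬ Irreducible (conicQuartic c) ∨ conicQuartic c = C (c 2) * developableQuartic K := by
  have h4 : (4 : K) ≠ 0 := by
    have := mul_ne_zero h2 h2
    norm_num at this ⊢
    exact this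
  have two : (C 2 : MvPolynomial (Fin 4) K) = 2 := map_ofNat C 2
  have four : (C 4 : MvPolynomial (Fin 4) K) = 4 := map_ofNat C 4
  have hsq {k : K} (hk : k ≠ 0) (hs : IsSquare (C k * conicQuartic c)) :
      ¬ Irreducible (conicQuartic c) := fun h =>
    hs.not_irreducible ((irreducible_isUnit_mul (hk.isUnit.map C)).2 h)
  have C0 {x : K} (hx : x = 0) : (C x : MvPolynomial (Fin 4) K) = 0 := by rw [hx, C_0]
  by_cases hA : c 0 = 0
  · by_cases hH : c 5 = 0
    · have hB : c 1 = 0 := (pow_eq_zero_iff two_ne_zero).1 (by linear_combination e0 + 4 * c 2 * hA)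
      have hE : c 4 = 0 := (pow_eq_zero_iff two_ne_zero).1 (by linear_combination e4 + 4 * c 2 * hH)
      have hD : c 3 * (c 3 + 4 * c 2) = 0 := by
        linear_combination e2 + 2 * c 4 * hB + 4 * c 5 * hA
      rcases mul_eq_zero.1 hD with hD | hD
      · refine Or.inl fun h => ?_
        by_cases hC : c 2 = 0
        · exact h.ne_zero (by simp [conicQuartic, conic, hA, hB, hC, hD, hE, hH])
        · refine hsq hC ⟨C (c 2) * netQuadric X 1, ?_⟩ h
          simp [conicQuartic, conic, hA, hB, hD, hE, hH]
          ring
      · right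
        have hD' := eq_neg_of_add_eq_zero_left hD
        simp [conicQuartic, developableQuartic, conic, discCoeff, hA, hB, hD', hE, hH, four]
        ring
    · refine Or.inl (hsq (mul_ne_zero h4 hH) ⟨C (c 3) * netQuadric X 0 + C (c 4) * netQuadric X 1
        + C (2 * c 5) * netQuadric X 2, ?_⟩)
      have k0 := C0 (x := 4 * c 5 * c 0 - c 3 ^ 2) <| (mul_eq_zero.1 (by
        linear_combination -c 5 * e2 + c 4 * e3 - c 3 * e4)).resolve_left hH
      have k1 := C0 (x := 4 * c 5 * c 1 - 2 * c 3 * c 4) (by linear_combination -2 * e3)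
      have k2 := C0 (x := 4 * c 5 * c 2 - c 4 ^ 2) (by linear_combination -e4)
      simp only [conicQuartic, conic, map_mul, map_sub, map_pow, two, four] at *
      linear_combination k0 * netQuadric X 0 ^ 2 + k1 * (netQuadric X 0 * netQuadric X 1)
        + k2 * netQuadric X 1 ^ 2
  · refine Or.inl (hsq (mul_ne_zero h4 hA) ⟨C (2 * c 0) * netQuadric X 0
      + C (c 1) * netQuadric X 1 + C (c 3) * netQuadric X 2, ?_⟩)
    have k2 := C0 (x := 4 * c 0 * c 2 - c 1 ^ 2) (by linear_combination -e0)
    have k4 := C0 (x := 4 * c 0 * c 4 - 2 * c 1 * c 3) (by linear_combination -2 * e1)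
    have k5 := C0 (x := 4 * c 0 * c 5 - c 3 ^ 2) <| (mul_eq_zero.1 (by
      linear_combination -c 0 * e2 + c 1 * e1 - c 3 * e0)).resolve_left hA
    simp only [conicQuartic, conic, map_mul, map_sub, map_pow, two, four] at *
    linear_combination k2 * netQuadric X 1 ^ 2 + k4 * (netQuadric X 1 * netQuadric X 2)
      + k5 * netQuadric X 2 ^ 2

/-- L_t is spanned by the polar values (1, -t, -2t²) and (0, 1, t), with cross product (t², -t, 1).
The discriminant of c on L_t is -4 times the adjugate form at this vector, and it vanishes because
the restriction is a square. -/
lemma conic_discriminant_of_isCusp (c : Fin 6 → K) (t : K)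
    (h : IsCusp (planeSection (conicQuartic c) (veronese ![1, t]) ![0, 0, 1, 0] ![0, 0, 0, 1])) :
    (c 1 ^ 2 - 4 * c 0 * c 2) + 2 * (c 1 * c 3 - 2 * c 0 * c 4) * t
      + (c 3 ^ 2 - 2 * c 1 * c 4 - 4 * c 0 * c 5 + 4 * c 3 * c 2) * t ^ 2
      + 2 * (c 3 * c 4 - 2 * c 1 * c 5) * t ^ 3 + (c 4 ^ 2 - 4 * c 2 * c 5) * t ^ 4 = 0 := by
  obtain ⟨-, -, l, hl, -, e⟩ := h
  obtain ⟨x, y, rfl⟩ : ∃ x y, l = C x * X 0 + C y * X 1 := by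
    refine ⟨coeff (Finsupp.equivFunOnFinite.symm ![1, 0]) l,
      coeff (Finsupp.equivFunOnFinite.symm ![0, 1]) l,
      (eq_sum_antidiagonalTuple_of_isHomogeneous hl).trans ?_⟩
    rw [Finset.Nat.antidiagonalTuple_two]
    simp [Finset.Nat.antidiagonal_succ]
    exact add_comm _ _
  rw [homogeneousComponent_planeSection_conicQuartic _ (netQuadric_veronese _), if_pos rfl,
    if_neg (by decide), if_neg (by decide), add_zero, add_zero] at e
  -- Values at (1, 0), (0, 1) and (1, 1) recover the three coefficients of the binary form.
  have key (r s : K) := congrArg (eval ![r, s]) e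
  simp [map_conic, map_netPolar, genericVector] at key
  have h10 := key 1 0
  have h01 := key 0 1
  have h11 := key 1 1
  simp [conic, netPolar, veronese_eq] at h10 h01 h11
  have cross : c 1 - 2 * c 2 * t + c 3 * t - 3 * c 4 * t ^ 2 - 4 * c 5 * t ^ 3 = 2 * x * y := by
    linear_combination h11 - h10 - h01
  linear_combination (c 1 - 2 * c 2 * t + c 3 * t - 3 * c 4 * t ^ 2 - 4 * c 5 * t ^ 3
    + 2 * x * y) * cross - 4 * (c 2 + c 4 * t + c 5 * t ^ 2) * h10 - 4 * x ^ 2 * h01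

lemma eq_developableQuartic_of_hasCuspidalTwistedCubic [Infinite K] (h2 : (2 : K) ≠ 0)
    {G : MvPolynomial (Fin 4) K} (hG : G.IsHomogeneous 4) (hirr : Irreducible G)
    (hcusp : HasCuspidalTwistedCubic G) : ∃ c : K, c ≠ 0 ∧ G = C c * developableQuartic K := by
  obtain ⟨E, hE, hcusp⟩ := hcusp
  have hS := infinite_affine_parameter hE
  have hcusp' (t : K) (ht : t ∈ {t : K | ∃ h : ![1, t] ≠ 0, Projectivization.mk K ![1, t] h ∉ E}) :
      IsCusp (planeSection G (veronese ![1, t]) ![0, 0, 1, 0] ![0, 0, 0, 1]) :=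
    hcusp _ ht.1 ht.2 _ _ (isTransversalPlane_affine t)
  obtain ⟨c, rfl⟩ := exists_eq_conicQuartic hG hS fun t ht => by
    obtain ⟨h0, h1, -⟩ := hcusp' t ht
    obtain ⟨k0, k1, k2⟩ :=
      eval_pderiv_planeSection G (veronese ![1, t]) ![0, 0, 1, 0] ![0, 0, 0, 1]
    rw [eval_eq_zero_of_homogeneousComponent h0] at k0
    rw [eval_pderiv_eq_zero_of_homogeneousComponent _ h1] at k1 k2
    exact ⟨k0.symm, by simpa [Fin.sum_univ_four] using k1.symm,
      by simpa [Fin.sum_univ_four] using k2.symm⟩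
  have hf := coeff_eq_zero_of_infinite hS (f := ![c 1 ^ 2 - 4 * c 0 * c 2,
      2 * (c 1 * c 3 - 2 * c 0 * c 4),
      c 3 ^ 2 - 2 * c 1 * c 4 - 4 * c 0 * c 5 + 4 * c 3 * c 2,
      2 * (c 3 * c 4 - 2 * c 1 * c 5), c 4 ^ 2 - 4 * c 2 * c 5]) fun t ht => by
    simp [Fin.sum_univ_succ]
    linear_combination conic_discriminant_of_isCusp c t (hcusp' t ht)
  rcases conicQuartic_not_irreducible_or_eq h2 c (congrFun hf 0)
    ((mul_eq_zero.1 (congrFun hf 1)).resolve_left h2) (congrFun hf 2)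
    ((mul_eq_zero.1 (congrFun hf 3)).resolve_left h2) (congrFun hf 4) with h | h
  · exact absurd hirr h
  · refine ⟨c 2, fun h0 => hirr.ne_zero ?_, h⟩
    rw [h, h0, C_0, zero_mul]

lemma zeroLocus_C_mul {c : K} (hc : c ≠ 0) (F : MvPolynomial (Fin 4) K) :
    zeroLocus (C c * F) = zeroLocus F := by
  simp [zeroLocus, hc]

end CuspidalQuartic

end

theorem theorem6p1 {K : Type*} [Field K] [IsAlgClosed K] (h2 : (2 : K) ≠ 0) :
    ∃ F : MvPolynomial (Fin 4) K,
      (F.IsHomogeneous 4 ∧ Irreducible F ∧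
        CuspidalQuartic.zeroLocus F = CuspidalQuartic.tangentialDevelopable K ∧
        CuspidalQuartic.HasCuspidalTwistedCubic F ∧
        CuspidalQuartic.HasOrdinaryCuspsAlongTwistedCubic F) ∧
      ∀ G : MvPolynomial (Fin 4) K, G.IsHomogeneous 4 → Irreducible G →
        CuspidalQuartic.HasCuspidalTwistedCubic G →
          CuspidalQuartic.zeroLocus G = CuspidalQuartic.tangentialDevelopable K ∧
          ∃ c : K, c ≠ 0 ∧ G = MvPolynomial.C c * F := by
  have hord := CuspidalQuartic.hasOrdinaryCusps_developableQuartic h2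
  have hzero := CuspidalQuartic.zeroLocus_developableQuartic h2
  refine ⟨CuspidalQuartic.developableQuartic K,
    ⟨CuspidalQuartic.isHomogeneous_conicQuartic _,
      CuspidalQuartic.irreducible_developableQuartic h2, hzero, hord.hasCuspidalTwistedCubic,
      hord⟩, fun G hG hirr hcusp => ?_⟩
  obtain ⟨c, hc, rfl⟩ :=
    CuspidalQuartic.eq_developableQuartic_of_hasCuspidalTwistedCubic h2 hG hirr hcusp
  exact ⟨(CuspidalQuartic.zeroLocus_C_mul hc _).trans hzero, c, hc, rfl⟩
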